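/- Let $Q$ be a tree network with $n$ nodes and hence $n-1$ arcs, all of unit length, regarded as a metric space with its path metric $d$. A search from a point $O\in Q$ is a map $S:[0,\infty)\to Q$ with $S(0)=O$ and $d(S(t_1),S(t_2))\le t_2-t_1$ for all $0\le t_1<t_2$. Let $T(S,x)=\min\{t\ge 0: S(t)=x\}$ (with value $\infty$ if $x$ is never reached), let $e$ be the equiprobable distribution, which gives weight $1/n$ to each node, including the root, and let $V_O(e)=\inf_S \int_Q T(S,x)\,de(x)$ be the optimal expected search time from $O$. (i) For every node $O$, the infimum is attained by some search, and $$V_O(e)=n-1-\bar d_e(O),\qquad \bar d_e(O)=\frac1n\sum_{v}d(O,v),$$ where the sum is over all nodes $v$ (including $O$). Thus $V_O(e)$ is the number of arcs minus the mean distance from $O$ to the nodes. (ii) If $n\ge 2$, then a point $p$ of $Q$ (a node or an interior point of an arc) is an optimal depot, that is, $V_p(e)\le V_q(e)$ for all $q\in Q$, if and only if $p$ is a leaf node (a node of degree one) whose closeness centrality is minimum among the leaf nodes. Here the closeness centrality of a node is the reciprocal of its mean distance to all other nodes. (iii) An endpoint of a longest path need not be an optimal depot: there is a tree with unit length arcs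 and a leaf node $x$ of minimum closeness centrality in it such that $V_x(e)<V_a(e)$ for every endpoint $a$ of a longest path. -/

import Mathlib

open scoped ENNReal NNReal
open MeasureTheory

noncomputable section

namespace DeliveryMan

variable {V : Type*}

/-! ### The metric network of a tree with unit length arcs

The network is realised inside `V → ℝ` with the sup metric: a node `v` is the vector of its
distances to all nodes, and an arc joining `u` and `v` is the straight segment between the two
vectors.  When `G` is a tree this is the network with its path metric; see `dist_node`,
`dist_arcPoint` and `exists_dist_arcPoint_eq` below. -/

/-- The vector of distances from the node `v` to all nodes. -/
def nodeVec (G : SimpleGraph V) (v : V) : V → ℝ := fun w => (G.dist v w : ℝ)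

/-- The network `Q`: all nodes and all points of all (unit length) arcs. -/
abbrev Network (G : SimpleGraph V) : Type _ :=
  {p : V → ℝ // (∃ v, p = nodeVec G v) ∨
    ∃ u v, G.Adj u v ∧ p ∈ segment ℝ (nodeVec G u) (nodeVec G v)}

/-- A node, as a point of the network. -/
def node (G : SimpleGraph V) (v : V) : Network G := ⟨nodeVec G v, Or.inl ⟨v, rfl⟩⟩

/-- The point of the arc from `u` to `v` at distance `s` from `u`. -/
def arcPoint (G : SimpleGraph V) {u v : V} (h : G.Adj u v) (s : ℝ) (hs : s ∈ Set.Icc (0 : ℝ) 1) :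
    Network G :=
  ⟨(1 - s) • nodeVec G u + s • nodeVec G v,
    Or.inr ⟨u, v, h, 1 - s, s, by linarith [hs.2], hs.1, by ring, rfl⟩⟩

theorem arcPoint_zero (G : SimpleGraph V) {u v : V} (h : G.Adj u v) :
    arcPoint G h 0 (by simp) = node G u := by
  ext1; simp [arcPoint, node]

theorem arcPoint_one (G : SimpleGraph V) {u v : V} (h : G.Adj u v) :
    arcPoint G h 1 (by simp) = node G v := by
  ext1; simp [arcPoint, node]

theorem arcPoint_symm (G : SimpleGraph V) {u v : V} (h : G.Adj u v) (s : ℝ)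
    (hs : s ∈ Set.Icc (0 : ℝ) 1) :
    arcPoint G h s hs = arcPoint G h.symm (1 - s) ⟨by linarith [hs.2], by linarith [hs.1]⟩ := by
  ext1
  simp only [arcPoint, sub_sub_cancel]
  rw [add_comm]

/-! ### The metric is the path metric -/

theorem dist_add_two_of_nearest {G : SimpleGraph V} (hG : G.IsTree) {u v a b : V}
    (h : G.Adj u v) (h' : G.Adj a b) (hne : s(u, v) ≠ s(a, b))
    (h1 : G.dist v a ≤ G.dist u a) (h2 : G.dist v a ≤ G.dist v b) :
    G.dist u a = G.dist v a + 1 ∧ G.dist v b = G.dist v a + 1 ∧ G.dist u b = G.dist v a + 2 := by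
  have e1 := hG.dist_eq_dist_add_one_of_adj a h
  have e2 := hG.dist_eq_dist_add_one_of_adj v h'
  have e3 := hG.dist_eq_dist_add_one_of_adj b h
  have e4 := hG.dist_eq_dist_add_one_of_adj u h'
  rw [G.dist_comm (u := a) (v := u), G.dist_comm (u := a) (v := v)] at e1
  rw [G.dist_comm (u := b) (v := u), G.dist_comm (u := b) (v := v)] at e3
  have f1 : G.dist u a = G.dist v a + 1 := by omega
  have f2 : G.dist v b = G.dist v a + 1 := by omega
  refine ⟨f1, f2, ?_⟩
  by_contra hcon
  have f3 : G.dist u b = G.dist v a := by omega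
  obtain ⟨p, hp⟩ := hG.connected.exists_walk_length_eq_dist v a
  obtain ⟨q, hq⟩ := hG.connected.exists_walk_length_eq_dist u b
  have hP : (p.concat h').IsPath :=
    SimpleGraph.Walk.isPath_of_length_eq_dist _ (by rw [SimpleGraph.Walk.length_concat]; omega)
  have hR : (SimpleGraph.Walk.cons h.symm q).IsPath :=
    SimpleGraph.Walk.isPath_of_length_eq_dist _ (by rw [SimpleGraph.Walk.length_cons]; omega)
  have heq : p.concat h' = SimpleGraph.Walk.cons h.symm q :=
    congrArg Subtype.val ((hG.isAcyclic.subsingleton_path v b).elim ⟨_, hP⟩ ⟨_, hR⟩)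
  have hu : u ∈ (p.concat h').support := by
    rw [heq]; simp
  rw [SimpleGraph.Walk.support_concat, List.mem_append, List.mem_singleton] at hu
  rcases hu with hu | rfl
  · classical
    have := G.dist_le (p.dropUntil u hu)
    have := p.length_dropUntil_le_length hu
    omega
  · rw [G.dist_self] at f3
    have : v = a := (hG.connected.dist_eq_zero_iff).1 f3.symm
    subst this
    exact hne Sym2.eq_swap

variable [Fintype V]

/-- The distance between two nodes is the number of arcs between them. -/
theorem dist_node {G : SimpleGraph V} (hG : G.IsTree) (u v : V) :
    dist (node G u) (node G v) = (G.dist u v : ℝ) := by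
  apply le_antisymm
  · refine (dist_pi_le_iff (by positivity)).2 fun w => ?_
    have h1 := hG.connected.dist_triangle (u := u) (v := v) (w := w)
    have h2 := hG.connected.dist_triangle (u := v) (v := u) (w := w)
    rw [G.dist_comm (u := v) (v := u)] at h2
    have h1' : (G.dist u w : ℝ) ≤ G.dist u v + G.dist v w := by exact_mod_cast h1
    have h2' : (G.dist v w : ℝ) ≤ G.dist u v + G.dist u w := by exact_mod_cast h2
    rw [Real.dist_eq, abs_le]
    simp only [node, nodeVec]
    constructor <;> linarith
  · have h := dist_le_pi_dist (nodeVec G u) (nodeVec G v) v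
    simp only [nodeVec, G.dist_self, Real.dist_eq, Nat.cast_zero, sub_zero, Nat.abs_cast] at h
    exact h

/-- Each arc is isometric to the unit interval. -/
theorem dist_arcPoint {G : SimpleGraph V} (hG : G.IsTree) {u v : V} (h : G.Adj u v) (s t : ℝ)
    (hs : s ∈ Set.Icc (0 : ℝ) 1) (ht : t ∈ Set.Icc (0 : ℝ) 1) :
    dist (arcPoint G h s hs) (arcPoint G h t ht) = |s - t| := by
  have huv : dist (nodeVec G u) (nodeVec G v) = 1 := by
    have h1 := dist_node hG u v
    rw [SimpleGraph.dist_eq_one_iff_adj.2 h] at h1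
    rw [Nat.cast_one] at h1
    exact h1
  change dist ((1 - s) • nodeVec G u + s • nodeVec G v)
    ((1 - t) • nodeVec G u + t • nodeVec G v) = |s - t|
  rw [dist_eq_norm] at huv ⊢
  have : (1 - s) • nodeVec G u + s • nodeVec G v - ((1 - t) • nodeVec G u + t • nodeVec G v)
      = (t - s) • (nodeVec G u - nodeVec G v) := by
    module
  rw [this, norm_smul, huv, mul_one, Real.norm_eq_abs, abs_sub_comm]

/-- The distance between points of two different arcs is the length of the shortest route through
an endpoint of each arc. -/
theorem exists_dist_arcPoint_eq {G : SimpleGraph V} (hG : G.IsTree) {u v a b : V}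
    (h : G.Adj u v) (h' : G.Adj a b) (hne : s(u, v) ≠ s(a, b)) (s t : ℝ)
    (hs : s ∈ Set.Icc (0 : ℝ) 1) (ht : t ∈ Set.Icc (0 : ℝ) 1) :
    ∃ x ∈ ({u, v} : Set V), ∃ y ∈ ({a, b} : Set V),
      dist (arcPoint G h s hs) (arcPoint G h' t ht) =
        dist (arcPoint G h s hs) (node G x) + (G.dist x y : ℝ) +
          dist (node G y) (arcPoint G h' t ht) := by
  have key : ∀ {u v a b : V} (h : G.Adj u v) (h' : G.Adj a b) (_ : s(u, v) ≠ s(a, b)) (s t : ℝ)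
      (hs : s ∈ Set.Icc (0 : ℝ) 1) (ht : t ∈ Set.Icc (0 : ℝ) 1),
      G.dist v a ≤ G.dist u a → G.dist v a ≤ G.dist v b →
      dist (arcPoint G h s hs) (arcPoint G h' t ht) =
        dist (arcPoint G h s hs) (node G v) + (G.dist v a : ℝ) +
          dist (node G a) (arcPoint G h' t ht) := by
    intro u v a b h h' hne s t hs ht h1 h2
    obtain ⟨g1, g2, g3⟩ := dist_add_two_of_nearest hG h h' hne h1 h2
    apply le_antisymm
    · rw [← dist_node hG]
      exact dist_triangle4 _ _ _ _
    · rw [← arcPoint_one G h, ← arcPoint_zero G h', dist_arcPoint hG, dist_arcPoint hG]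
      have hb := dist_le_pi_dist (arcPoint G h s hs).1 (arcPoint G h' t ht).1 b
      refine le_trans (le_trans ?_ (le_abs_self _)) hb
      simp only [arcPoint, nodeVec, Pi.add_apply, Pi.smul_apply, smul_eq_mul, g2, g3,
        G.dist_self, SimpleGraph.dist_eq_one_iff_adj.2 h']
      rw [abs_of_nonpos (by linarith [hs.2]), abs_of_nonpos (by linarith [ht.1])]
      push_cast
      linarith
  have hs' : 1 - s ∈ Set.Icc (0 : ℝ) 1 := ⟨by linarith [hs.2], by linarith [hs.1]⟩
  have ht' : 1 - t ∈ Set.Icc (0 : ℝ) 1 := ⟨by linarith [ht.2], by linarith [ht.1]⟩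
  have e1 := hG.dist_eq_dist_add_one_of_adj a h
  have e2 := hG.dist_eq_dist_add_one_of_adj v h'
  have e3 := hG.dist_eq_dist_add_one_of_adj b h
  have e4 := hG.dist_eq_dist_add_one_of_adj u h'
  rw [G.dist_comm (u := a) (v := u), G.dist_comm (u := a) (v := v)] at e1
  rw [G.dist_comm (u := b) (v := u), G.dist_comm (u := b) (v := v)] at e3
  have hsw : s(v, u) ≠ s(a, b) := by rwa [Sym2.eq_swap]
  have hsw' : s(u, v) ≠ s(b, a) := by rwa [Sym2.eq_swap (a := b)]
  have hsw2 : s(v, u) ≠ s(b, a) := by rwa [Sym2.eq_swap (a := b)]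
  have hcases : (G.dist v a ≤ G.dist u a ∧ G.dist v a ≤ G.dist v b) ∨
      (G.dist u a ≤ G.dist v a ∧ G.dist u a ≤ G.dist u b) ∨
      (G.dist v b ≤ G.dist u b ∧ G.dist v b ≤ G.dist v a) ∨
      (G.dist u b ≤ G.dist v b ∧ G.dist u b ≤ G.dist u a) := by omega
  rcases hcases with ⟨c1, c2⟩ | ⟨c1, c2⟩ | ⟨c1, c2⟩ | ⟨c1, c2⟩
  · exact ⟨v, by simp, a, by simp, key h h' hne s t hs ht c1 c2⟩
  · refine ⟨u, by simp, a, by simp, ?_⟩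
    rw [arcPoint_symm G h]
    exact key h.symm h' hsw (1 - s) t hs' ht c1 c2
  · refine ⟨v, by simp, b, by simp, ?_⟩
    rw [arcPoint_symm G h']
    exact key h h'.symm hsw' s (1 - t) hs ht' c1 c2
  · refine ⟨u, by simp, b, by simp, ?_⟩
    rw [arcPoint_symm G h, arcPoint_symm G h']
    exact key h.symm h'.symm hsw2 (1 - s) (1 - t) hs' ht' c1 c2

/-! ### Searches and expected search time -/

variable {G : SimpleGraph V}

/-- A search starting at `O`: a path in the network with `S(0) = O` and
`d(S(t₁), S(t₂)) ≤ t₂ - t₁` for all `0 ≤ t₁ < t₂`. -/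
structure IsSearch (O : Network G) (S : ℝ≥0 → Network G) : Prop where
  start : S 0 = O
  speed : ∀ t₁ t₂ : ℝ≥0, t₁ < t₂ → dist (S t₁) (S t₂) ≤ (t₂ : ℝ) - t₁

/-- The first time at which `S` reaches `x` (`∞` if it never does). -/
def searchTime (S : ℝ≥0 → Network G) (x : Network G) : ℝ≥0∞ :=
  ⨅ (t : ℝ≥0) (_ : S t = x), (t : ℝ≥0∞)

/-- The expected search time of `S` against the hiding distribution `h`. -/
def expectedTime (S : ℝ≥0 → Network G) (h : Measure (Network G)) : ℝ≥0∞ :=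
  ∫⁻ x, searchTime S x ∂h

/-- `S` is an optimal search from `O` against `h`. -/
def IsOptimalSearch (O : Network G) (h : Measure (Network G)) (S : ℝ≥0 → Network G) : Prop :=
  IsSearch O S ∧ ∀ S', IsSearch O S' → expectedTime S h ≤ expectedTime S' h

/-- The optimal expected search time from `O` against `h`. -/
def optimalTime (O : Network G) (h : Measure (Network G)) : ℝ≥0∞ :=
  ⨅ (S : ℝ≥0 → Network G) (_ : IsSearch O S), expectedTime S h

/-- The equiprobable distribution: equal weight on each node (including the root). -/
def equiprobable (G : SimpleGraph V) : Measure (Network G) :=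
  ∑ v : V, (Fintype.card V : ℝ≥0∞)⁻¹ • Measure.dirac (node G v)

/-! ### Depots, mean distance and closeness centrality -/

/-- The point `p` (a node or a point inside an arc) is an optimal starting point. -/
def IsOptimalDepot (p : Network G) : Prop :=
  ∀ q : Network G, optimalTime p (equiprobable G) ≤ optimalTime q (equiprobable G)

/-- The mean distance from the node `x` to all nodes, including `x` itself. -/
def meanNodeDist (G : SimpleGraph V) (x : V) : ℝ :=
  (∑ y : V, dist (node G x) (node G y)) / (Fintype.card V : ℝ)

/-- Closeness centrality: the reciprocal of the mean distance from `x` to all other nodes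
(the term `y = x` of the sum vanishes). -/
def closeness (G : SimpleGraph V) (x : V) : ℝ :=
  ((∑ y : V, dist (node G x) (node G y)) / ((Fintype.card V : ℝ) - 1))⁻¹

/-- A leaf node: a node of degree one. -/
def IsLeaf (G : SimpleGraph V) (x : V) : Prop := ∃! y, G.Adj x y

/-- `x` is a leaf node of minimum closeness centrality among the leaf nodes. -/
def IsMinClosenessLeaf (G : SimpleGraph V) (x : V) : Prop :=
  IsLeaf G x ∧ ∀ y, IsLeaf G y → closeness G x ≤ closeness G y

/-- `a` is an endpoint of a longest path of the tree. -/
def IsLongestPathEnd (G : SimpleGraph V) (a : V) : Prop :=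
  ∃ (b : V) (p : G.Walk a b), p.IsPath ∧
    ∀ (u v : V) (q : G.Walk u v), q.IsPath → q.length ≤ p.length

end DeliveryMan

end

/-!
The expected search time is governed by how a search sweeps out the tree.  A walk from a node `O`
to a node `v`, closed up by the path back to `O`, crosses every arc of the subtree it has visited
at least twice.  So if `v` is preceded by `k` other nodes in the order of first visits, it is
reached no earlier than time `2 * k - d(O, v)` (`two_mul_card_support_le`), and summation over `v`,
in which `k` runs through `0, …, n - 1`, gives `n * (n - 1) - ∑ d(O, v)` as a lower bound for the
sum of the visiting times (`card_mul_le_sum_times`).  Searches in the network enter only through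
their first visiting times, which are realised by walks in the tree (`exists_walk_of_times`).
Depth-first search gives equality: when it reaches a new node, the arcs on the path from `O` to
that node have been traversed once and all other visited arcs twice
(`exists_depthFirst_walk`).  This is the formula for the optimal time from a node.

A search from the interior of an arc enters the set of nodes through one of the two endpoints of
the arc, and loses against a start at that endpoint at least the time it takes to get there
(`ofReal_min_le_optimalTime_arcPoint`); hence an optimal depot is a node, and by the formula a node
of maximum farness (sum of distances to all nodes).  Farness is strictly convex along the paths of
the tree (`two_mul_farness_lt`), since of two different neighbours of a node at most one is closer
to a given node; so its maximum is attained at leaves only, and among these closeness is the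
decreasing function `(n - 1) / farness`.

For the last claim, two arms of equal length from a common root fan out into several leaves, which
are the endpoints of the longest paths, while the end of a shorter third arm is far from both groups
of leaves and so has larger farness than any of them (`exampleTree`).
-/

open scoped ENNReal NNReal
open MeasureTheory

noncomputable section

namespace DeliveryMan

variable {V : Type*} {G : SimpleGraph V}

/-! ### Points of the network -/

/-- Every point of the network is a node or a proper interior point of an arc. -/
theorem network_cases (p : Network G) :
    (∃ x, p = node G x) ∨
      ∃ (a b : V) (h : G.Adj a b) (s : ℝ) (hs : s ∈ Set.Icc (0 : ℝ) 1), 0 < s ∧ s < 1 ∧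
        p = arcPoint G h s hs := by
  obtain ⟨p, ⟨x, rfl⟩ | ⟨a, b, h, α, s, hα, hs, hsum, rfl⟩⟩ := p
  · exact Or.inl ⟨x, rfl⟩
  obtain rfl : α = 1 - s := by linarith
  have hmem : s ∈ Set.Icc (0 : ℝ) 1 := ⟨hs, by linarith⟩
  rcases hs.eq_or_lt with rfl | hs0
  · exact Or.inl ⟨a, arcPoint_zero G h⟩
  rcases hmem.2.eq_or_lt with rfl | hs1
  · exact Or.inl ⟨b, arcPoint_one G h⟩
  exact Or.inr ⟨a, b, h, s, hmem, hs0, hs1, rfl⟩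

/-! ### Walks in a tree -/

/-- In a tree rooted at `O`, every walk from `w` to `O` passes through the parent of `w`. -/
theorem mem_support_of_dist_eq_add_one (hG : G.IsTree) {O w y : V} (h : G.Adj w y)
    (hd : G.dist w O = G.dist y O + 1) (p : G.Walk w O) : y ∈ p.support := by
  classical
  obtain ⟨q, hq⟩ := hG.connected.exists_walk_length_eq_dist y O
  have hP : (SimpleGraph.Walk.cons h q).IsPath :=
    SimpleGraph.Walk.isPath_of_length_eq_dist _ (by rw [SimpleGraph.Walk.length_cons]; omega)
  have heq : p.bypass = SimpleGraph.Walk.cons h q :=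
    congrArg Subtype.val
      ((hG.isAcyclic.subsingleton_path w O).elim ⟨_, p.bypass_isPath⟩ ⟨_, hP⟩)
  apply p.support_bypass_subset_support
  rw [heq]
  simp

/-- The parent of a node in a rooted tree is unique. -/
theorem eq_of_dist_eq_add_one (hG : G.IsTree) {O w y z : V} (hy : G.Adj w y) (hz : G.Adj w z)
    (hdy : G.dist w O = G.dist y O + 1) (hdz : G.dist w O = G.dist z O + 1) : y = z := by
  obtain ⟨q, hq⟩ := hG.connected.exists_walk_length_eq_dist z O
  have hmem := mem_support_of_dist_eq_add_one hG hy hdy (SimpleGraph.Walk.cons hz q)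
  rw [SimpleGraph.Walk.support_cons, List.mem_cons] at hmem
  rcases hmem with rfl | hmem
  · exact absurd rfl hy.ne
  · classical
    have h1 := congrArg SimpleGraph.Walk.length (q.take_spec hmem)
    rw [SimpleGraph.Walk.length_append] at h1
    have h2 := G.dist_le (q.dropUntil y hmem)
    have h3 : (q.takeUntil y hmem).length = 0 := by omega
    exact (SimpleGraph.Walk.eq_of_length_eq_zero h3).symm

theorem adj_dist_cases (hG : G.IsTree) (O : V) {u v : V} (h : G.Adj u v) :
    G.dist u O = G.dist v O + 1 ∨ G.dist v O = G.dist u O + 1 := by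
  have := hG.dist_eq_dist_add_one_of_adj O h
  rw [G.dist_comm (u := O) (v := u), G.dist_comm (u := O) (v := v)] at this
  omega

/-- A node other than the root has a neighbour one step closer to the root. -/
theorem exists_adj_dist_eq_add_one (hG : G.IsTree) {O w : V} (h : w ≠ O) :
    ∃ y, G.Adj w y ∧ G.dist w O = G.dist y O + 1 := by
  obtain ⟨q, hq⟩ := hG.connected.exists_walk_length_eq_dist w O
  cases q with
  | nil => exact absurd rfl h
  | @cons _ y _ hy q =>
    refine ⟨y, hy, ?_⟩
    have h1 := G.dist_le q
    have h2 := adj_dist_cases hG O hy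
    rw [SimpleGraph.Walk.length_cons] at hq
    omega

/-- A closed walk crosses each arc it uses at least twice, so a walk together with the way back
to its start is at least twice as long as the subtree it visits. -/
theorem two_mul_card_support_le [DecidableEq V] (hG : G.IsTree) {w O : V} (p : G.Walk w O) :
    2 * p.support.toFinset.card ≤ p.length + G.dist w O + 2 := by
  induction p with
  | nil => simp
  | @cons w y O h p ih =>
    rw [SimpleGraph.Walk.support_cons, List.toFinset_cons, SimpleGraph.Walk.length_cons]
    have hc := adj_dist_cases hG O h
    by_cases hw : w ∈ p.support
    · rw [Finset.insert_eq_of_mem (List.mem_toFinset.2 hw)]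
      omega
    · have h1 : G.dist y O ≠ G.dist w O + 1 := fun h1 =>
        hw (mem_support_of_dist_eq_add_one hG h.symm h1 p)
      rw [Finset.card_insert_of_notMem (by simpa using hw)]
      omega

/-! ### The lower bound -/

/-- Visiting times realisable at unit speed from `a` are realised by walks: the node `v` can be
reached by a walk of length at most `τ v` that has passed through every node visited earlier. -/
theorem exists_walk_of_times [Finite V] (hG : G.Connected) {τ : V → ℝ} {a : V}
    (ha : ∀ v, (G.dist a v : ℝ) ≤ τ v)
    (hτ : ∀ u v, τ u ≤ τ v → (G.dist u v : ℝ) ≤ τ v - τ u) (v : V) :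
    ∃ p : G.Walk a v, (p.length : ℝ) ≤ τ v ∧ ∀ u, τ u ≤ τ v → u ∈ p.support := by
  have hwf : WellFounded (fun u v => τ u < τ v) :=
    have : IsTrans V (fun u v => τ u < τ v) := ⟨fun _ _ _ => lt_trans⟩
    have : Std.Irrefl (fun u v => τ u < τ v) := ⟨fun _ => lt_irrefl _⟩
    Finite.wellFounded_of_trans_of_irrefl _
  have htie : ∀ u v, τ u = τ v → u = v := by
    intro u v h
    have h1 := hτ u v h.le
    rw [h, sub_self] at h1
    exact hG.dist_eq_zero_iff.1 (Nat.le_zero.1 (by exact_mod_cast h1))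
  induction v using hwf.induction with
  | _ v ih =>
  by_cases hne : {u | τ u < τ v}.Nonempty
  · -- the node visited just before `v`
    obtain ⟨w, hw, hmax⟩ := Set.exists_max_image _ τ (Set.toFinite {u | τ u < τ v}) hne
    obtain ⟨p, hp, hps⟩ := ih w hw
    obtain ⟨q, hq⟩ := hG.exists_walk_length_eq_dist w v
    refine ⟨p.append q, ?_, fun u hu => ?_⟩
    · have := hτ w v (le_of_lt hw)
      rw [SimpleGraph.Walk.length_append, hq]
      push_cast
      linarith
    · rw [SimpleGraph.Walk.mem_support_append_iff]
      rcases hu.lt_or_eq with hu | hu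
      · exact Or.inl (hps u (hmax u hu))
      · rw [htie u v hu]
        exact Or.inr q.end_mem_support
  · obtain ⟨q, hq⟩ := hG.exists_walk_length_eq_dist a v
    refine ⟨q, hq ▸ ha v, fun u hu => ?_⟩
    rcases hu.lt_or_eq with hu | hu
    · exact absurd ⟨u, hu⟩ hne
    · rw [htie u v hu]
      exact q.end_mem_support

variable [Fintype V]

variable (G) in
/-- The farness of a node: the sum of its distances to all nodes. -/
def farness (x : V) : ℕ := ∑ v, G.dist x v

/-- The lower bound for the sum of the visiting times of a search from `a`. -/
theorem card_mul_le_sum_times (hG : G.IsTree) {τ : V → ℝ} {a : V}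
    (ha : ∀ v, (G.dist a v : ℝ) ≤ τ v)
    (hτ : ∀ u v, τ u ≤ τ v → (G.dist u v : ℝ) ≤ τ v - τ u) :
    (Fintype.card V : ℝ) * (Fintype.card V - 1) ≤ ∑ v, τ v + farness G a := by
  classical
  have hkey : ∀ v, 2 * (({u | τ u < τ v} : Finset V).card : ℝ) ≤ τ v + G.dist a v := by
    intro v
    obtain ⟨p, hp, hps⟩ := exists_walk_of_times hG.connected ha hτ v
    have h1 := two_mul_card_support_le hG p.reverse
    rw [SimpleGraph.Walk.support_reverse, List.toFinset_reverse, SimpleGraph.Walk.length_reverse,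
      G.dist_comm] at h1
    have h2 : insert v ({u | τ u < τ v} : Finset V) ⊆ p.support.toFinset := by
      intro u hu
      rw [List.mem_toFinset]
      apply hps
      simp only [Finset.mem_insert, Finset.mem_filter_univ] at hu
      rcases hu with rfl | hu
      · exact le_rfl
      · exact hu.le
    have h3 := Finset.card_le_card h2
    rw [Finset.card_insert_of_notMem (by simp)] at h3
    have h4 : 2 * ({u | τ u < τ v} : Finset V).card ≤ p.length + G.dist a v := by omega
    have h5 : 2 * (({u | τ u < τ v} : Finset V).card : ℝ) ≤ p.length + G.dist a v := by
      exact_mod_cast h4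
    linarith
  have htie : ∀ u v, u ≠ v → τ u ≠ τ v := by
    intro u v h he
    have h1 := hτ u v he.le
    rw [he, sub_self] at h1
    exact h (hG.connected.dist_eq_zero_iff.1 (Nat.le_zero.1 (by exact_mod_cast h1)))
  -- of two different nodes exactly one is visited before the other
  have hcount : ∑ v, 2 * (({u | τ u < τ v} : Finset V).card : ℝ) =
      (Fintype.card V : ℝ) * (Fintype.card V - 1) := by
    have hswap : ∑ v, (({u | τ u < τ v} : Finset V).card : ℝ) =
        ∑ v, (({u | τ v < τ u} : Finset V).card : ℝ) := by
      simp only [Finset.card_filter, Nat.cast_sum]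
      exact Finset.sum_comm
    have hv : ∀ v, (({u | τ u < τ v} : Finset V).card : ℝ) +
        (({u | τ v < τ u} : Finset V).card : ℝ) = Fintype.card V - 1 := by
      intro v
      have h1 : ({u | τ u < τ v} : Finset V) ∪ ({u | τ v < τ u} : Finset V) =
          Finset.univ.erase v := by
        ext u
        simp only [Finset.mem_union, Finset.mem_filter_univ, Finset.mem_erase, Finset.mem_univ,
          and_true]
        constructor
        · rintro h rfl
          simp at h
        · exact fun h => lt_or_gt_of_ne (htie u v h)
      have h2 : Disjoint ({u | τ u < τ v} : Finset V) ({u | τ v < τ u} : Finset V) :=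
        Finset.disjoint_filter.2 fun u _ h => h.le.not_gt
      rw [← Nat.cast_add, ← Finset.card_union_of_disjoint h2, h1,
        Finset.card_erase_of_mem (Finset.mem_univ v), Finset.card_univ,
        Nat.cast_sub (Fintype.card_pos_iff.2 ⟨v⟩), Nat.cast_one]
    rw [← Finset.mul_sum, two_mul]
    nth_rewrite 2 [hswap]
    rw [← Finset.sum_add_distrib, Finset.sum_congr rfl fun v _ => hv v, Finset.sum_const,
      Finset.card_univ, nsmul_eq_mul]
  rw [← hcount, farness, Nat.cast_sum, ← Finset.sum_add_distrib]
  exact Finset.sum_le_sum fun v _ => hkey v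

/-! ### Depth-first search -/

/-- Depth-first search, continued from the moment `c` at which the set `A` of nodes has been
visited and the searcher is at `w`. The hypothesis `hc` says that the arcs between `w` and the
root `O` have been traversed once and all other visited arcs twice, `hpar` that `A` is closed
under passing to the parent, and `hdone` that the searcher has left no visited node behind with
an unvisited neighbour, except ancestors of `w` (including `w`). The remaining nodes are reached at
the times `c + τ v`; the `k`-th of them (starting from `k = A.card`) contributes `2 * k` to the sum,
which is written without subtraction of `A.card * (A.card - 1)`. -/
theorem exists_depthFirst_walk [DecidableEq V] (hG : G.IsTree) (O : V) (N : ℕ) (A : Finset V)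
    (w : V) (c : ℕ) (hN : 2 * Aᶜ.card + G.dist w O ≤ N) (hO : O ∈ A) (hw : w ∈ A)
    (hc : c + G.dist w O + 2 = 2 * A.card)
    (hpar : ∀ x ∈ A, ∀ y, G.Adj x y → G.dist x O = G.dist y O + 1 → y ∈ A)
    (hdone : ∀ x ∈ A, G.dist w O < G.dist w x + G.dist x O → ∀ y, G.Adj x y → y ∈ A) :
    ∃ (z : V) (p : G.Walk w z) (τ : V → ℕ), (∀ v ∈ Aᶜ, p.getVert (τ v) = v) ∧
      ∑ v ∈ Aᶜ, (c + τ v + G.dist v O) + A.card * A.card =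
        Fintype.card V * (Fintype.card V - 1) + A.card := by
  induction N generalizing A w c with
  | zero =>
    have h1 : Aᶜ = ∅ := Finset.card_eq_zero.1 (by omega)
    have h2 : A = Finset.univ := by simpa using h1
    have : 0 < Fintype.card V := Fintype.card_pos_iff.2 ⟨O⟩
    obtain ⟨k, hk⟩ : ∃ k, Fintype.card V = k + 1 := ⟨Fintype.card V - 1, by omega⟩
    refine ⟨w, .nil, 0, by simp [h1], ?_⟩
    rw [h1, h2, Finset.card_univ, Finset.sum_empty, hk, Nat.add_sub_cancel]
    ring
  | succ N ih =>
    by_cases hnew : ∃ y, G.Adj w y ∧ y ∉ A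
    · -- descend to an unvisited child
      obtain ⟨y, hy, hyA⟩ := hnew
      have hdy : G.dist y O = G.dist w O + 1 :=
        (adj_dist_cases hG O hy).resolve_left fun h => hyA (hpar w hw y hy h)
      have hcard : (insert y A).card = A.card + 1 := Finset.card_insert_of_notMem hyA
      have hcompl : Aᶜ = insert y (insert y A)ᶜ := by
        ext v
        simp only [Finset.mem_compl, Finset.mem_insert]
        by_cases hv : v = y <;> simp [hv, hyA]
      have hyn : y ∉ (insert y A)ᶜ := by simp
      have hcc : Aᶜ.card = (insert y A)ᶜ.card + 1 := by
        rw [hcompl, Finset.card_insert_of_notMem hyn]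
      obtain ⟨z, p, τ, hp, hsum⟩ := ih (insert y A) y (c + 1) (by omega)
        (Finset.mem_insert_of_mem hO) (Finset.mem_insert_self _ _) (by omega)
        (by
          intro x hx x' hxx' hd
          rcases Finset.mem_insert.1 hx with rfl | hx
          · rw [eq_of_dist_eq_add_one hG hxx' hy.symm hd hdy]
            exact Finset.mem_insert_of_mem hw
          · exact Finset.mem_insert_of_mem (hpar x hx x' hxx' hd))
        (by
          intro x hx hd x' hxx'
          rcases Finset.mem_insert.1 hx with rfl | hx
          · rw [G.dist_self] at hd
            omega
          · refine Finset.mem_insert_of_mem (hdone x hx ?_ x' hxx')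
            have := adj_dist_cases hG x hy
            omega)
      refine ⟨z, .cons hy p, fun v => if v = y then 1 else τ v + 1, fun v hv => ?_, ?_⟩
      · dsimp only
        split_ifs with h
        · simp [h]
        · rw [SimpleGraph.Walk.getVert_cons_succ]
          exact hp v (by simpa [h] using hv)
      · have hsum' : ∑ v ∈ (insert y A)ᶜ, (c + (if v = y then 1 else τ v + 1) + G.dist v O) =
            ∑ v ∈ (insert y A)ᶜ, (c + 1 + τ v + G.dist v O) := by
          refine Finset.sum_congr rfl fun v hv => ?_
          rw [if_neg (by rintro rfl; exact hyn hv)]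
          ring
        dsimp only
        rw [hcompl, Finset.sum_insert hyn, if_pos rfl, hsum']
        rw [hcard] at hsum
        have : c + 1 + G.dist y O = 2 * A.card := by omega
        rw [this]
        linarith
    · push Not at hnew
      by_cases hwO : w = O
      · -- back at the root, nothing is left
        subst hwO
        have hcl : ∀ x ∈ A, ∀ y, G.Adj x y → y ∈ A := by
          intro x hx
          by_cases hxw : x = w
          · subst hxw
            exact hnew
          · refine hdone x hx ?_
            have := hG.connected.pos_dist_of_ne hxw
            rw [G.dist_self]
            omega
        have huniv : A = Finset.univ := by
          refine Finset.eq_univ_of_forall fun v => ?_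
          obtain ⟨q⟩ := hG.connected.preconnected w v
          clear ih hdone hpar hc hN hO
          induction q with
          | nil => exact hw
          | cons h q ihq => exact ihq (hcl _ hw _ h) (hcl _ (hcl _ hw _ h))
        obtain ⟨k, hk⟩ : ∃ k, Fintype.card V = k + 1 :=
          ⟨Fintype.card V - 1, by have : 0 < Fintype.card V := Fintype.card_pos_iff.2 ⟨w⟩; omega⟩
        refine ⟨w, .nil, 0, by simp [huniv], ?_⟩
        rw [huniv, Finset.compl_univ, Finset.sum_empty, Finset.card_univ, hk, Nat.add_sub_cancel]
        ring
      · -- return to the parent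
        obtain ⟨y, hy, hdy⟩ := exists_adj_dist_eq_add_one hG hwO
        obtain ⟨z, p, τ, hp, hsum⟩ := ih A y (c + 1) (by omega) hO (hnew y hy) (by omega) hpar
          (by
            intro x hx hd
            by_cases hxw : x = w
            · subst hxw
              exact hnew
            · refine hdone x hx ?_
              by_contra hcon
              obtain ⟨y', hy', hdy'⟩ := exists_adj_dist_eq_add_one hG (Ne.symm hxw)
              have h1 := hG.connected.dist_triangle (u := y') (v := x) (w := O)
              have h2 := adj_dist_cases hG O hy'
              have h3 : y' = y := eq_of_dist_eq_add_one hG hy' hy (by omega) hdy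
              subst h3
              omega)
        refine ⟨z, .cons hy p, fun v => τ v + 1, fun v hv => ?_, ?_⟩
        · rw [SimpleGraph.Walk.getVert_cons_succ]
          exact hp v hv
        · rw [← hsum]
          congr 1
          exact Finset.sum_congr rfl fun v _ => by ring

/-- A walk from `O` whose visiting times attain the lower bound `card_mul_le_sum_times`. -/
theorem exists_walk_sum_times_eq (hG : G.IsTree) (O : V) :
    ∃ (z : V) (p : G.Walk O z) (τ : V → ℕ), (∀ v, p.getVert (τ v) = v) ∧
      ∑ v, τ v + farness G O = Fintype.card V * (Fintype.card V - 1) := by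
  classical
  have hO : ∀ x ∈ ({O} : Finset V), x = O := fun x => Finset.mem_singleton.1
  obtain ⟨z, p, τ, hp, hsum⟩ := exists_depthFirst_walk hG O _ {O} O 0 le_rfl (by simp) (by simp)
    (by simp) (by
      intro x hx y _ hd
      rw [hO x hx, G.dist_self] at hd
      omega)
    (by
      intro x hx hd
      rw [hO x hx, G.dist_self] at hd
      omega)
  refine ⟨z, p, fun v => if v = O then 0 else τ v, fun v => ?_, ?_⟩
  · dsimp only
    split_ifs with h
    · rw [SimpleGraph.Walk.getVert_zero, h]
    · exact hp v (by simpa using h)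
  · rw [farness, ← Finset.sum_add_distrib, ← Finset.sum_add_sum_compl {O}]
    rw [Finset.card_singleton, Finset.sum_congr rfl (g := fun v =>
      (if v = O then 0 else τ v) + G.dist O v) (fun v hv => by
        rw [if_neg (by simpa using hv), zero_add, G.dist_comm])] at hsum
    rw [Finset.sum_singleton, if_pos rfl, G.dist_self]
    omega

/-! ### Searches and visiting times -/

theorem IsSearch.dist_le {O : Network G} {S : ℝ≥0 → Network G} (hS : IsSearch O S) {t₁ t₂ : ℝ≥0}
    (h : t₁ ≤ t₂) : dist (S t₁) (S t₂) ≤ (t₂ : ℝ) - t₁ := by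
  rcases h.eq_or_lt with rfl | h
  · simp
  · exact hS.speed t₁ t₂ h

theorem IsSearch.continuous {O : Network G} {S : ℝ≥0 → Network G} (hS : IsSearch O S) :
    Continuous S := by
  refine LipschitzWith.continuous (K := 1) (LipschitzWith.of_dist_le_mul fun t₁ t₂ => ?_)
  rw [NNReal.coe_one, one_mul, NNReal.dist_eq]
  rcases le_total t₁ t₂ with h | h
  · rw [abs_sub_comm]
    exact (hS.dist_le h).trans (le_abs_self _)
  · rw [dist_comm]
    exact (hS.dist_le h).trans (le_abs_self _)

/-- A point that is reached at all is reached at a first time. -/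
theorem IsSearch.exists_searchTime_eq {O : Network G} {S : ℝ≥0 → Network G} (hS : IsSearch O S)
    {x : Network G} (hx : searchTime S x ≠ ∞) :
    ∃ t : ℝ≥0, S t = x ∧ searchTime S x = t := by
  have hne : {t | S t = x}.Nonempty := by
    by_contra h
    rw [Set.not_nonempty_iff_eq_empty] at h
    refine hx ?_
    rw [searchTime, iInf₂_eq_top]
    exact fun t ht => absurd (h ▸ ht : t ∈ (∅ : Set ℝ≥0)) (Set.notMem_empty t)
  have hclosed : IsClosed {t | S t = x} := isClosed_eq hS.continuous continuous_const
  have hmem : sInf {t | S t = x} ∈ {t | S t = x} := hclosed.csInf_mem hne (OrderBot.bddBelow _)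
  refine ⟨sInf {t | S t = x}, hmem, le_antisymm (iInf₂_le _ hmem) (le_iInf₂ fun t ht => ?_)⟩
  exact ENNReal.coe_le_coe.2 (csInf_le (OrderBot.bddBelow _) ht)

theorem expectedTime_equiprobable (S : ℝ≥0 → Network G) :
    expectedTime S (equiprobable G) =
      (Fintype.card V : ℝ≥0∞)⁻¹ * ∑ v, searchTime S (node G v) := by
  rw [expectedTime, equiprobable, lintegral_finsetSum_measure, Finset.mul_sum]
  refine Finset.sum_congr rfl fun v _ => ?_
  rw [lintegral_smul_measure, lintegral_dirac, smul_eq_mul]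

/-- The data of a search with finite expected time that matter for the lower bound. -/
theorem IsSearch.exists_times (hG : G.IsTree) {p : Network G} {S : ℝ≥0 → Network G}
    (hS : IsSearch p S) (htop : expectedTime S (equiprobable G) ≠ ∞) :
    ∃ τ : V → ℝ, (∀ v, dist p (node G v) ≤ τ v) ∧
      (∀ u v, τ u ≤ τ v → (G.dist u v : ℝ) ≤ τ v - τ u) ∧
      expectedTime S (equiprobable G) = ENNReal.ofReal ((∑ v, τ v) / Fintype.card V) := by
  have hpos : 0 < Fintype.card V := Fintype.card_pos_iff.2 hG.connected.nonempty
  have hfin : ∀ v, searchTime S (node G v) ≠ ∞ := by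
    intro v hv
    refine htop ?_
    rw [expectedTime_equiprobable, ENNReal.sum_eq_top.2 ⟨v, Finset.mem_univ v, hv⟩]
    exact ENNReal.mul_top (ENNReal.inv_ne_zero.2 (ENNReal.natCast_ne_top _))
  choose t ht hst using fun v => hS.exists_searchTime_eq (hfin v)
  refine ⟨fun v => t v, fun v => ?_, fun u v huv => ?_, ?_⟩
  · have := hS.dist_le (zero_le (a := t v))
    rwa [hS.start, ht, NNReal.coe_zero, sub_zero] at this
  · rw [← dist_node hG, ← ht u, ← ht v]
    exact hS.dist_le (NNReal.coe_le_coe.1 huv)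
  · rw [expectedTime_equiprobable, Finset.sum_congr rfl fun v _ => hst v, div_eq_inv_mul,
      ENNReal.ofReal_mul (by positivity), ENNReal.ofReal_inv_of_pos (by exact_mod_cast hpos),
      ENNReal.ofReal_natCast, ENNReal.ofReal_sum_of_nonneg fun v _ => (t v).coe_nonneg]
    simp only [ENNReal.ofReal_coe_nnreal]

/-- A walk in the tree is traced out by a search at unit speed. -/
theorem exists_isSearch_of_walk (hG : G.IsTree) {u v : V} (p : G.Walk u v) :
    ∃ S : ℝ≥0 → Network G, IsSearch (node G u) S ∧ ∀ k : ℕ, S k = node G (p.getVert k) := by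
  induction p with
  | @nil u =>
    refine ⟨fun _ => node G u, ⟨rfl, fun t₁ t₂ h => ?_⟩, fun k => rfl⟩
    rw [dist_self, sub_nonneg]
    exact_mod_cast h.le
  | @cons u w v h p ih =>
    obtain ⟨S, hS, hSp⟩ := ih
    have hI : ∀ t : ℝ≥0, t ≤ 1 → (t : ℝ) ∈ Set.Icc (0 : ℝ) 1 := fun t ht =>
      ⟨t.coe_nonneg, by exact_mod_cast ht⟩
    refine ⟨fun t => if ht : t ≤ 1 then arcPoint G h t (hI t ht) else S (t - 1), ⟨?_, ?_⟩, ?_⟩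
    · rw [dif_pos zero_le_one]
      exact arcPoint_zero G h
    · intro t₁ t₂ hlt
      have hlt' : (t₁ : ℝ) < t₂ := by exact_mod_cast hlt
      by_cases h2 : t₂ ≤ 1
      · rw [dif_pos (hlt.le.trans h2), dif_pos h2, dist_arcPoint hG, abs_sub_comm,
          abs_of_nonneg (by linarith)]
      · rw [not_le] at h2
        rw [dif_neg h2.not_ge]
        by_cases h1 : t₁ ≤ 1
        · have h1' : (t₁ : ℝ) ≤ 1 := by exact_mod_cast h1
          rw [dif_pos h1]
          refine (dist_triangle _ (node G w) _).trans ?_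
          have e1 : dist (arcPoint G h t₁ (hI t₁ h1)) (node G w) = 1 - t₁ := by
            rw [← arcPoint_one G h, dist_arcPoint hG, abs_sub_comm, abs_of_nonneg (by linarith)]
          have e2 := hS.dist_le (zero_le (a := t₂ - 1))
          rw [hS.start, NNReal.coe_sub h2.le, NNReal.coe_zero, NNReal.coe_one] at e2
          linarith
        · rw [not_le] at h1
          rw [dif_neg h1.not_ge]
          have e := hS.dist_le (tsub_le_tsub_right hlt.le 1)
          rw [NNReal.coe_sub h2.le, NNReal.coe_sub h1.le] at e
          linarith
    · intro k
      dsimp only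
      cases k with
      | zero =>
        rw [dif_pos (by simp)]
        simpa using arcPoint_zero G h
      | succ k =>
        rw [SimpleGraph.Walk.getVert_cons_succ]
        split_ifs with hk
        · have hk0 : k = 0 := by
            have : k + 1 ≤ 1 := by exact_mod_cast hk
            omega
          subst hk0
          simpa using arcPoint_one G h
        · rw [← hSp k]
          congr 1
          push_cast
          exact add_tsub_cancel_right _ _

/-! ### The optimal time from a node -/

variable (G) in
/-- The number of arcs minus the mean distance from `x` to the nodes. -/
def depotValue (x : V) : ℝ := (Fintype.card V : ℝ) - 1 - meanNodeDist G x

theorem meanNodeDist_eq (hG : G.IsTree) (x : V) :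
    meanNodeDist G x = (farness G x : ℝ) / Fintype.card V := by
  simp only [meanNodeDist, farness, dist_node hG, Nat.cast_sum]

theorem depotValue_eq_div (hG : G.IsTree) (x : V) :
    depotValue G x =
      ((Fintype.card V : ℝ) * (Fintype.card V - 1) - farness G x) / Fintype.card V := by
  have hpos : (0 : ℝ) < Fintype.card V := by
    exact_mod_cast Fintype.card_pos_iff.2 hG.connected.nonempty
  rw [depotValue, meanNodeDist_eq hG]
  field_simp

theorem depotValue_nonneg (hG : G.IsTree) (x : V) : 0 ≤ depotValue G x := by
  obtain ⟨_, _, τ, _, hsum⟩ := exists_walk_sum_times_eq hG x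
  have hpos : 0 < Fintype.card V := Fintype.card_pos_iff.2 hG.connected.nonempty
  rw [depotValue_eq_div hG]
  have h : (∑ v, τ v : ℝ) + farness G x = Fintype.card V * (Fintype.card V - 1) := by
    have := congrArg (Nat.cast (R := ℝ)) hsum
    push_cast [Nat.cast_sub (show 1 ≤ Fintype.card V from hpos)] at this
    exact this
  rw [← h, add_sub_cancel_right]
  positivity

theorem exists_isSearch_expectedTime_le (hG : G.IsTree) (O : V) :
    ∃ S, IsSearch (node G O) S ∧
      expectedTime S (equiprobable G) ≤ ENNReal.ofReal (depotValue G O) := by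
  obtain ⟨z, p, τ, hp, hsum⟩ := exists_walk_sum_times_eq hG O
  obtain ⟨S, hS, hSp⟩ := exists_isSearch_of_walk hG p
  have hpos : 0 < Fintype.card V := Fintype.card_pos_iff.2 hG.connected.nonempty
  refine ⟨S, hS, ?_⟩
  have h : (Fintype.card V : ℝ) * (Fintype.card V - 1) - farness G O = (∑ v, τ v : ℕ) := by
    have := congrArg (Nat.cast (R := ℝ)) hsum
    rw [Nat.cast_add, Nat.cast_mul, Nat.cast_sub (show 1 ≤ Fintype.card V from hpos),
      Nat.cast_one] at this
    linarith
  rw [expectedTime_equiprobable, depotValue_eq_div hG, h, div_eq_inv_mul,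
    ENNReal.ofReal_mul (by positivity), ENNReal.ofReal_inv_of_pos (by exact_mod_cast hpos),
    ENNReal.ofReal_natCast, ENNReal.ofReal_natCast, Nat.cast_sum]
  gcongr with v
  refine (iInf₂_le (τ v : ℝ≥0) ?_).trans (by simp)
  rw [hSp, hp]

/-- If every node is reached at least `δ` later than it could have been reached from the node
`a`, then the expected time exceeds the value of `a` by at least `δ`. -/
theorem depotValue_add_le (hG : G.IsTree) {τ : V → ℝ} {a : V} {δ : ℝ}
    (ha : ∀ v, δ + (G.dist a v : ℝ) ≤ τ v)
    (hτ : ∀ u v, τ u ≤ τ v → (G.dist u v : ℝ) ≤ τ v - τ u) :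
    depotValue G a + δ ≤ (∑ v, τ v) / Fintype.card V := by
  have hpos : (0 : ℝ) < Fintype.card V := by
    exact_mod_cast Fintype.card_pos_iff.2 hG.connected.nonempty
  have h := card_mul_le_sum_times hG (τ := fun v => τ v - δ) (a := a)
    (fun v => by linarith [ha v]) (fun u v huv => by linarith [hτ u v (by linarith)])
  rw [Finset.sum_sub_distrib, Finset.sum_const, Finset.card_univ, nsmul_eq_mul] at h
  rw [depotValue_eq_div hG, le_div_iff₀ hpos, add_mul, div_mul_cancel₀ _ hpos.ne']
  linarith

theorem ofReal_depotValue_le (hG : G.IsTree) {O : V} {S : ℝ≥0 → Network G}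
    (hS : IsSearch (node G O) S) :
    ENNReal.ofReal (depotValue G O) ≤ expectedTime S (equiprobable G) := by
  by_cases htop : expectedTime S (equiprobable G) = ∞
  · rw [htop]
    exact le_top
  obtain ⟨τ, h1, h2, h3⟩ := hS.exists_times hG htop
  rw [h3]
  have := depotValue_add_le hG (δ := 0) (a := O)
    (fun v => by rw [zero_add, ← dist_node hG]; exact h1 v) h2
  exact ENNReal.ofReal_le_ofReal (by linarith)

theorem optimalTime_node (hG : G.IsTree) (O : V) :
    optimalTime (node G O) (equiprobable G) = ENNReal.ofReal (depotValue G O) := by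
  obtain ⟨S, hS, hle⟩ := exists_isSearch_expectedTime_le hG O
  exact le_antisymm ((iInf₂_le S hS).trans hle) (le_iInf₂ fun S hS => ofReal_depotValue_le hG hS)

theorem exists_isOptimalSearch (hG : G.IsTree) (O : V) :
    ∃ S, IsOptimalSearch (node G O) (equiprobable G) S := by
  obtain ⟨S, hS, hle⟩ := exists_isSearch_expectedTime_le hG O
  exact ⟨S, hS, fun S' hS' => hle.trans (ofReal_depotValue_le hG hS')⟩

/-! ### Starting points inside an arc -/

/-- The way from an interior point of an arc to a node leads through an endpoint of the arc. -/
theorem dist_arcPoint_node_cases (hG : G.IsTree) {a b : V} (h : G.Adj a b) {s : ℝ}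
    (hs : s ∈ Set.Icc (0 : ℝ) 1) (v : V) :
    s + (G.dist a v : ℝ) ≤ dist (arcPoint G h s hs) (node G v) ∨
      1 - s + (G.dist b v : ℝ) ≤ dist (arcPoint G h s hs) (node G v) := by
  -- the coordinate `v` alone already gives the distance to `node G v`
  have hv := (le_abs_self _).trans
    (dist_le_pi_dist (arcPoint G h s hs).1 (node G v).1 v)
  have hv' : (1 - s) * (G.dist a v : ℝ) + s * G.dist b v ≤
      dist (arcPoint G h s hs) (node G v) := by
    refine le_trans (le_of_eq ?_) hv
    simp [arcPoint, node, nodeVec]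
  rcases adj_dist_cases hG v h with hd | hd
  · right
    rw [hd] at hv'
    push_cast at hv'
    linarith
  · left
    rw [hd] at hv'
    push_cast at hv'
    linarith

/-- Starting inside an arc is no better than starting at the endpoint that is reached first, and
worse by at least the time needed to get there. -/
theorem ofReal_min_le_optimalTime_arcPoint (hG : G.IsTree) {a b : V} (h : G.Adj a b) {s : ℝ}
    (hs : s ∈ Set.Icc (0 : ℝ) 1) :
    ENNReal.ofReal (min (depotValue G a + s) (depotValue G b + (1 - s))) ≤
      optimalTime (arcPoint G h s hs) (equiprobable G) := by
  refine le_iInf₂ fun S hS => ?_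
  by_cases htop : expectedTime S (equiprobable G) = ∞
  · rw [htop]
    exact le_top
  obtain ⟨τ, h1, h2, h3⟩ := hS.exists_times hG htop
  rw [h3]
  apply ENNReal.ofReal_le_ofReal
  have : Nonempty V := ⟨a⟩
  -- the endpoint through which the first node `w` is reached serves for all nodes
  obtain ⟨w, hw⟩ := Finite.exists_min τ
  have hall : ∀ (x : V) (δ : ℝ), δ + (G.dist x w : ℝ) ≤ τ w →
      ∀ v, δ + (G.dist x v : ℝ) ≤ τ v := by
    intro x δ hx v
    have e1 := h2 w v (hw v)
    have e2 : (G.dist x v : ℝ) ≤ G.dist x w + G.dist w v := by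
      exact_mod_cast hG.connected.dist_triangle
    linarith
  rcases dist_arcPoint_node_cases hG h hs w with hd | hd
  · exact (min_le_left _ _).trans (depotValue_add_le hG (hall a s (hd.trans (h1 w))) h2)
  · exact (min_le_right _ _).trans (depotValue_add_le hG (hall b _ (hd.trans (h1 w))) h2)

/-- Every starting point inside an arc is beaten by an endpoint of the arc. -/
theorem exists_optimalTime_node_lt (hG : G.IsTree) {a b : V} (h : G.Adj a b) {s : ℝ}
    (hs : s ∈ Set.Icc (0 : ℝ) 1) (hs0 : 0 < s) (hs1 : s < 1) :
    ∃ x, optimalTime (node G x) (equiprobable G) <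
      optimalTime (arcPoint G h s hs) (equiprobable G) := by
  have hle := ofReal_min_le_optimalTime_arcPoint hG h hs
  have ha := depotValue_nonneg hG a
  have hb := depotValue_nonneg hG b
  rcases min_choice (depotValue G a + s) (depotValue G b + (1 - s)) with hm | hm <;> rw [hm] at hle
  · refine ⟨a, lt_of_lt_of_le ?_ hle⟩
    rw [optimalTime_node hG, ENNReal.ofReal_lt_ofReal_iff (by linarith)]
    linarith
  · refine ⟨b, lt_of_lt_of_le ?_ hle⟩
    rw [optimalTime_node hG, ENNReal.ofReal_lt_ofReal_iff (by linarith)]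
    linarith

/-! ### Optimal depots -/

theorem optimalTime_node_le_iff (hG : G.IsTree) (x y : V) :
    optimalTime (node G x) (equiprobable G) ≤ optimalTime (node G y) (equiprobable G) ↔
      farness G y ≤ farness G x := by
  have hpos : (0 : ℝ) < Fintype.card V := by
    exact_mod_cast Fintype.card_pos_iff.2 hG.connected.nonempty
  rw [optimalTime_node hG, optimalTime_node hG,
    ENNReal.ofReal_le_ofReal_iff (depotValue_nonneg hG y), depotValue_eq_div hG,
    depotValue_eq_div hG, div_le_div_iff_of_pos_right hpos, sub_le_sub_iff_left, Nat.cast_le]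

theorem isOptimalDepot_iff (hG : G.IsTree) (p : Network G) :
    IsOptimalDepot p ↔ ∃ x, p = node G x ∧ ∀ y, farness G y ≤ farness G x := by
  constructor
  · intro hp
    rcases network_cases p with ⟨x, rfl⟩ | ⟨a, b, h, s, hs, hs0, hs1, rfl⟩
    · exact ⟨x, rfl, fun y => (optimalTime_node_le_iff hG x y).1 (hp (node G y))⟩
    · obtain ⟨x, hx⟩ := exists_optimalTime_node_lt hG h hs hs0 hs1
      exact absurd (hp (node G x)) hx.not_ge
  · rintro ⟨x, rfl, hx⟩ q
    rcases network_cases q with ⟨y, rfl⟩ | ⟨a, b, h, s, hs, hs0, hs1, rfl⟩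
    · exact (optimalTime_node_le_iff hG x y).2 (hx y)
    · obtain ⟨y, hy⟩ := exists_optimalTime_node_lt hG h hs hs0 hs1
      exact ((optimalTime_node_le_iff hG x y).2 (hx y)).trans hy.le

/-- Farness is strictly convex at a node with two different neighbours. -/
theorem two_mul_farness_lt (hG : G.IsTree) {x b c : V} (hb : G.Adj x b) (hc : G.Adj x c)
    (hbc : b ≠ c) : 2 * farness G x < farness G b + farness G c := by
  rw [farness, farness, farness, Finset.mul_sum, ← Finset.sum_add_distrib]
  refine Finset.sum_lt_sum (fun v _ => ?_) ⟨x, Finset.mem_univ x, ?_⟩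
  · have h1 := adj_dist_cases hG v hb
    have h2 := adj_dist_cases hG v hc
    -- only one neighbour of `x` is closer to `v` than `x`
    have h3 : ¬ (G.dist x v = G.dist b v + 1 ∧ G.dist x v = G.dist c v + 1) := fun h3 =>
      hbc (eq_of_dist_eq_add_one hG hb hc h3.1 h3.2)
    omega
  · have := hG.connected.pos_dist_of_ne hb.ne'
    rw [G.dist_self]
    omega

theorem isLeaf_of_forall_farness_le (hG : G.IsTree) (hcard : 2 ≤ Fintype.card V) {x : V}
    (hx : ∀ y, farness G y ≤ farness G x) : IsLeaf G x := by
  have : Nontrivial V := Fintype.one_lt_card_iff_nontrivial.1 hcard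
  obtain ⟨y, hy⟩ := exists_ne x
  obtain ⟨b, hb, -⟩ := exists_adj_dist_eq_add_one hG hy.symm
  refine ⟨b, hb, fun c hc => ?_⟩
  by_contra hne
  have := two_mul_farness_lt hG hc hb hne
  have := hx b
  have := hx c
  omega

theorem closeness_le_closeness_iff (hG : G.IsTree) (hcard : 2 ≤ Fintype.card V) (x y : V) :
    closeness G x ≤ closeness G y ↔ farness G y ≤ farness G x := by
  have hcard' : (0 : ℝ) < (Fintype.card V : ℝ) - 1 := by
    have : (2 : ℝ) ≤ Fintype.card V := by exact_mod_cast hcard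
    linarith
  have : Nontrivial V := Fintype.one_lt_card_iff_nontrivial.1 hcard
  have hfar : ∀ z, (0 : ℝ) < farness G z := by
    intro z
    obtain ⟨w, hw⟩ := exists_ne z
    exact_mod_cast (hG.connected.pos_dist_of_ne hw.symm).trans_le
      (Finset.single_le_sum (f := fun v => G.dist z v) (fun _ _ => Nat.zero_le _)
        (Finset.mem_univ w))
  have hcl : ∀ z, closeness G z = ((farness G z : ℝ) / ((Fintype.card V : ℝ) - 1))⁻¹ := by
    intro z
    simp only [closeness, farness, dist_node hG, Nat.cast_sum]
  rw [hcl, hcl, inv_le_inv₀ (div_pos (hfar x) hcard') (div_pos (hfar y) hcard'),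
    div_le_div_iff_of_pos_right hcard', Nat.cast_le]

theorem isMinClosenessLeaf_iff (hG : G.IsTree) (hcard : 2 ≤ Fintype.card V) (x : V) :
    IsMinClosenessLeaf G x ↔ ∀ y, farness G y ≤ farness G x := by
  constructor
  · rintro ⟨-, hx⟩ y
    have : Nonempty V := ⟨x⟩
    obtain ⟨z, hz⟩ := Finite.exists_max (farness G)
    exact (hz y).trans ((closeness_le_closeness_iff hG hcard x z).1
      (hx z (isLeaf_of_forall_farness_le hG hcard hz)))
  · intro hx
    exact ⟨isLeaf_of_forall_farness_le hG hcard hx, fun y _ =>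
      (closeness_le_closeness_iff hG hcard x y).2 (hx y)⟩

/-! ### A tree whose optimal depot is not an endpoint of a longest path -/

/-- A function that vanishes at `u` and is changed by at most one along each arc, with a strictly
smaller value at some neighbour of each other node, is the distance from `u`. -/
theorem reachable_and_dist_eq {W : Type*} {T : SimpleGraph W} {u : W} (δ : W → ℕ) (hu : δ u = 0)
    (hle : ∀ v w, T.Adj v w → δ w ≤ δ v + 1)
    (hpred : ∀ v, v ≠ u → ∃ w, T.Adj w v ∧ δ w + 1 = δ v) (v : W) :
    T.Reachable u v ∧ T.dist u v = δ v := by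
  have hwalk : ∀ k v, δ v = k → ∃ p : T.Walk u v, p.length = δ v := by
    intro k
    induction k with
    | zero =>
      intro v hv
      by_cases h : v = u
      · subst h
        exact ⟨.nil, hu.symm⟩
      · obtain ⟨w, -, hw⟩ := hpred v h
        omega
    | succ k ih =>
      intro v hv
      obtain ⟨w, hwv, hw⟩ := hpred v (by rintro rfl; omega)
      obtain ⟨p, hp⟩ := ih w (by omega)
      exact ⟨p.concat hwv, by rw [SimpleGraph.Walk.length_concat]; omega⟩
  have hlen : ∀ (x y : W) (p : T.Walk x y), δ y ≤ δ x + p.length := by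
    intro x y p
    induction p with
    | nil => simp
    | cons h p ih =>
      have := hle _ _ h
      rw [SimpleGraph.Walk.length_cons]
      omega
  obtain ⟨p, hp⟩ := hwalk _ v rfl
  obtain ⟨q, hq⟩ := SimpleGraph.Reachable.exists_walk_length_eq_dist ⟨p⟩
  refine ⟨⟨p⟩, le_antisymm (hp ▸ T.dist_le p) ?_⟩
  have := hlen u v q
  omega

/-- The parents of the nodes of the example, which is rooted at `0`. There are two arms
`0, 1, 2` and `0, 6, 7` whose ends carry three leaves each, and a third arm `0, 11, 12`. -/
def exampleParent : Fin 13 → Fin 13 := ![0, 0, 1, 2, 2, 2, 0, 6, 7, 7, 7, 0, 11]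

/-- The example: the leaf `12` is too close to the root to be an endpoint of a longest path, but
far from all six leaves of the other arms, whereas each of these is close to the two leaves next
to it. -/
def exampleTree : SimpleGraph (Fin 13) := SimpleGraph.fromRel fun u v => exampleParent u = v

instance : DecidableRel exampleTree.Adj := fun u v =>
  inferInstanceAs (Decidable (u ≠ v ∧ (exampleParent u = v ∨ exampleParent v = u)))

/-- The distance in the example, in a form suited to evaluation. As parents have smaller labels,
the way between two nodes leads through the parent of the one with the larger label. The first
argument bounds the number of steps. -/
def exampleDist : ℕ → Fin 13 → Fin 13 → ℕ
  | 0, _, _ => 0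
  | k + 1, u, v =>
    if v < u then exampleDist k (exampleParent u) v + 1
    else if u < v then exampleDist k u (exampleParent v) + 1
    else 0

theorem reachable_and_dist_exampleTree (u v : Fin 13) :
    exampleTree.Reachable u v ∧ exampleTree.dist u v = exampleDist 6 u v := by
  have h1 : ∀ u, exampleDist 6 u u = 0 := by decide +kernel
  have h2 : ∀ u v w, exampleTree.Adj v w → exampleDist 6 u w ≤ exampleDist 6 u v + 1 := by
    decide +kernel
  have h3 : ∀ u v, v ≠ u →
      ∃ w, exampleTree.Adj w v ∧ exampleDist 6 u w + 1 = exampleDist 6 u v := by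
    decide +kernel
  exact reachable_and_dist_eq (exampleDist 6 u) (h1 u) (h2 u) (h3 u) v

theorem isTree_exampleTree : exampleTree.IsTree := by
  rw [SimpleGraph.isTree_iff_connected_and_card]
  refine ⟨⟨fun u v => (reachable_and_dist_exampleTree u v).1⟩, ?_⟩
  have h : exampleTree.edgeFinset.card = 12 := by decide +kernel
  rw [Nat.card_eq_fintype_card, ← SimpleGraph.edgeFinset_card, h, Nat.card_fin]

theorem farness_exampleTree (u : Fin 13) :
    farness exampleTree u = ∑ v, exampleDist 6 u v :=
  Finset.sum_congr rfl fun v _ => (reachable_and_dist_exampleTree u v).2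

theorem isMinClosenessLeaf_exampleTree : IsMinClosenessLeaf exampleTree 12 := by
  rw [isMinClosenessLeaf_iff isTree_exampleTree (by simp)]
  simp only [farness_exampleTree]
  decide +kernel

theorem farness_lt_of_isLongestPathEnd_exampleTree {a : Fin 13}
    (ha : IsLongestPathEnd exampleTree a) :
    farness exampleTree a < farness exampleTree 12 := by
  obtain ⟨b, p, hp, hmax⟩ := ha
  -- the nodes `3` and `8` are at distance `6`
  obtain ⟨q, hq, hql⟩ := isTree_exampleTree.connected.exists_path_of_dist 3 8
  have h6 : exampleDist 6 3 8 = 6 := by decide +kernel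
  have hlen := hmax 3 8 q hq
  rw [hql, (reachable_and_dist_exampleTree 3 8).2, h6] at hlen
  obtain ⟨r, hr, hrl⟩ := isTree_exampleTree.connected.exists_path_of_dist a b
  have hpr : p = r :=
    congrArg Subtype.val
      ((isTree_exampleTree.isAcyclic.subsingleton_path a b).elim ⟨p, hp⟩ ⟨r, hr⟩)
  rw [hpr, hrl, (reachable_and_dist_exampleTree a b).2] at hlen
  have hfar : ∀ u v, 6 ≤ exampleDist 6 u v →
      ∑ w, exampleDist 6 u w < ∑ w, exampleDist 6 12 w := by
    decide +kernel
  rw [farness_exampleTree, farness_exampleTree]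
  exact hfar a b hlen

end DeliveryMan

end

theorem mainTheorem7 {V : Type*} [Fintype V] (G : SimpleGraph V) (hG : G.IsTree)
    (n : ℕ) (hn : Fintype.card V = n) :
    -- (i) existence of an optimal search and the optimal expected search time from a root node
    (∀ O : V,
      (∃ S, DeliveryMan.IsOptimalSearch (DeliveryMan.node G O) (DeliveryMan.equiprobable G) S) ∧
      DeliveryMan.optimalTime (DeliveryMan.node G O) (DeliveryMan.equiprobable G) ≠ ⊤ ∧
      (DeliveryMan.optimalTime (DeliveryMan.node G O) (DeliveryMan.equiprobable G)).toReal =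
        (n : ℝ) - 1 - DeliveryMan.meanNodeDist G O) ∧
    -- (ii) the optimal depots are the leaf nodes of minimum closeness centrality
    (2 ≤ n → ∀ p : DeliveryMan.Network G,
      DeliveryMan.IsOptimalDepot p ↔
        ∃ x : V, p = DeliveryMan.node G x ∧ DeliveryMan.IsMinClosenessLeaf G x) ∧
    -- (iii) the endpoint of a longest path need not be an optimal depot
    (∃ (m : ℕ) (T : SimpleGraph (Fin m)), T.IsTree ∧
      ∃ x : Fin m, DeliveryMan.IsMinClosenessLeaf T x ∧
        ∀ a : Fin m, DeliveryMan.IsLongestPathEnd T a →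
          DeliveryMan.optimalTime (DeliveryMan.node T x) (DeliveryMan.equiprobable T) <
            DeliveryMan.optimalTime (DeliveryMan.node T a) (DeliveryMan.equiprobable T)) := by
  subst hn
  refine ⟨fun O => ⟨DeliveryMan.exists_isOptimalSearch hG O, ?_, ?_⟩, fun hcard p => ?_,
    13, DeliveryMan.exampleTree, DeliveryMan.isTree_exampleTree, 12,
    DeliveryMan.isMinClosenessLeaf_exampleTree, fun a ha => ?_⟩
  · rw [DeliveryMan.optimalTime_node hG]
    exact ENNReal.ofReal_ne_top
  · rw [DeliveryMan.optimalTime_node hG,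
      ENNReal.toReal_ofReal (DeliveryMan.depotValue_nonneg hG O), DeliveryMan.depotValue]
  · simp only [DeliveryMan.isOptimalDepot_iff hG, DeliveryMan.isMinClosenessLeaf_iff hG hcard]
  · rw [← not_le, DeliveryMan.optimalTime_node_le_iff DeliveryMan.isTree_exampleTree, not_le]
    exact DeliveryMan.farness_lt_of_isLongestPathEnd_exampleTree ha
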